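/- Let $\mathbb M_n$ be the algebra of complex $n\times n$ matrices, with the order $X\le Y$ meaning that $Y-X$ is positive semidefinite, and let $\Re X=\frac{X+X^*}{2}$. A matrix $A\in\mathbb M_n$ is called accretive if $\Re A$ is positive definite. Let $W(A)=\{x^*Ax : x\in\mathbb C^n,\ x^*x=1\}$ be the numerical range and, for $\alpha\in[0,\pi/2)$, let $S_\alpha=\{z\in\mathbb C : \Re z>0,\ |\Im z|\le \tan(\alpha)\,\Re z\}$. For accretive $A,B\in\mathbb M_n$ and $0<v<1$ let $$A\sharp_v B=\frac{\sin v\pi}{\pi}\int_0^\infty t^{v-1}\left(A^{-1}+tB^{-1}\right)^{-1}dt ,$$ and let $A\sharp_0B=A$, $A\sharp_1B=B$. For $h>0$ let $K(h)=\frac{(h+1)^2}{4h}$. Let $0\le v\le 1$, let $0<m\le M$ be real numbers, and let $h=M/m$. **(i)** Let $\alpha\in[0,\pi/2)$ and let $A,B\in\mathbb M_n$ satisfy $W(A),W(B)\subset S_\alpha$ and $mI_n\le \Re A,\ \Re B\le MI_n$. Then $$\bigl(\Re(A\sharp_vB)\bigr)^2\le \sec^4(\alpha)\,K(h)\,\bigl(\Re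 A\,\sharp_v\,\Re B\bigr)^2 .$$ **(ii)** Let $A,B\in\mathbb M_n$ be accretive with $mI_n\le \Re A,\ \Re B\le MI_n$. Then $$\bigl(\Re A\,\sharp_v\,\Re B\bigr)^2\le K(h)\,\bigl(\Re(A\sharp_vB)\bigr)^2 .$$ **(iii)** Let $\alpha\in[0,\pi/2)$ and let $A\in\mathbb M_n$ satisfy $W(A)\subset S_\alpha$ and $mI_n\le\Re A\le MI_n$. Then for every positive linear map $\Phi:\mathbb M_n\to\mathbb M_l$ (that is, $\Phi(X)\ge0$ whenever $X\ge0$) which is normalized, i.e. $\Phi(I_n)=I_l$, $$\bigl(\Phi((\Re A)^{-1})\bigr)^2\le \sec^4(\alpha)\,K(h)\,\bigl(\Phi(\Re(A^{-1}))\bigr)^2 .$$ -/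

import Mathlib

open scoped MatrixOrder ComplexOrder

noncomputable section

namespace SectorMatrix

/-- The real part `(A + A*) / 2` of a square complex matrix, as a matrix
(the coercion of Mathlib's `realPart`). -/
abbrev rePart {n : ℕ} (A : Matrix (Fin n) (Fin n) ℂ) : Matrix (Fin n) (Fin n) ℂ :=
  ((realPart A : selfAdjoint (Matrix (Fin n) (Fin n) ℂ)) : Matrix (Fin n) (Fin n) ℂ)

/-- A matrix is accretive if its real part is positive definite. -/
def IsAccretive {n : ℕ} (A : Matrix (Fin n) (Fin n) ℂ) : Prop :=
  (rePart A).PosDef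

/-- The sector `S_α = {z : Re z > 0, |Im z| ≤ tan α * Re z}`. -/
def sector (α : ℝ) : Set ℂ :=
  {z : ℂ | 0 < z.re ∧ |z.im| ≤ Real.tan α * z.re}

/-- The numerical range `W(A) = {x* A x : x* x = 1}`. -/
def numericalRange {n : ℕ} (A : Matrix (Fin n) (Fin n) ℂ) : Set ℂ :=
  {z : ℂ | ∃ x : Fin n → ℂ, star x ⬝ᵥ x = 1 ∧ z = star x ⬝ᵥ (A.mulVec x)}

/-- The Kantorovich constant `K(h) = (h + 1)² / (4 h)`. -/
def kantorovich (h : ℝ) : ℝ := (h + 1) ^ 2 / (4 * h)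

/-- The weighted geometric mean of accretive matrices: for `0 < v < 1`,
`A ♯_v B = (sin (v π) / π) ∫₀^∞ t^(v-1) (A⁻¹ + t B⁻¹)⁻¹ dt`, the integral of a matrix-valued
function being taken entry by entry; at the end points, `A ♯_0 B = A` and `A ♯_1 B = B`. -/
def geomMean {n : ℕ} (v : ℝ) (A B : Matrix (Fin n) (Fin n) ℂ) : Matrix (Fin n) (Fin n) ℂ :=
  if v = 0 then A
  else if v = 1 then B
  else (Real.sin (v * Real.pi) / Real.pi) •
    Matrix.of fun i j =>
      ∫ t in Set.Ioi (0 : ℝ), (t ^ (v - 1) : ℝ) • (A⁻¹ + t • B⁻¹)⁻¹ i j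

end SectorMatrix

end

/-! Write P, Q for the real parts of A, B. Three first-order comparisons carry everything: P ♯ Q ≤
Re(A ♯ B) (`geomMean_rePart_le`), Re(A ♯ B) ≤ sec²α (P ♯ Q) (`rePart_geomMean_le`) and P⁻¹ ≤ sec²α
Re(A⁻¹) (`inv_rePart_le`). Those for means are proved for the integrand at each t and then
integrated against quadratic forms.

Squaring does not preserve the order, but X ≤ Y implies X² ≤ K(M/m) Y² as soon as one of the two has
its spectrum in [m, M] (`sq_le_kantorovich_smul_sq` and its primed version). Monotonicity of ♯ keeps
P ♯ Q in [m, M]. It is the larger matrix, up to the factor sec²α, in (i) and the smaller in (ii); in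
(iii) the smaller matrix Φ(P⁻¹) lies in [1/M, 1/m], which has the same ratio h. -/

namespace SectorMatrix

open Matrix

/-! ### Real parts, inverses and parallel sums in the Loewner order. -/

section Algebra

variable {n : ℕ} {A B P Q X Y : Matrix (Fin n) (Fin n) ℂ}

theorem le_of_sub_eq_posSemidef (hX : X.PosSemidef) (h : B - A = X) : A ≤ B := by
  rw [Matrix.le_iff, h]
  exact hX

theorem rePart_eq (A : Matrix (Fin n) (Fin n) ℂ) : rePart A = (2 : ℝ)⁻¹ • (A + Aᴴ) :=
  realPart_apply_coe A

theorem isHermitian_rePart (A : Matrix (Fin n) (Fin n) ℂ) : (rePart A).IsHermitian :=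
  (realPart A).2

theorem rePart_add (A B : Matrix (Fin n) (Fin n) ℂ) :
    rePart (A + B) = rePart A + rePart B := by
  simp [rePart]

theorem rePart_smul (r : ℝ) (A : Matrix (Fin n) (Fin n) ℂ) :
    rePart (r • A) = r • rePart A := by
  simp [rePart]

theorem rePart_conjTranspose (A : Matrix (Fin n) (Fin n) ℂ) : rePart Aᴴ = rePart A := by
  rw [rePart_eq, rePart_eq, conjTranspose_conjTranspose, add_comm]

theorem _root_.Matrix.IsHermitian.rePart_eq_self (hA : A.IsHermitian) : rePart A = A := by
  rw [rePart_eq, hA.eq, ← two_smul ℝ A, smul_smul]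
  norm_num

theorem rePart_conj (A X : Matrix (Fin n) (Fin n) ℂ) :
    rePart (Xᴴ * A * X) = Xᴴ * rePart A * X := by
  simp only [rePart_eq, conjTranspose_mul, conjTranspose_conjTranspose, mul_add, add_mul,
    mul_assoc, mul_smul_comm, smul_mul_assoc]

theorem rePart_dotProduct (A : Matrix (Fin n) (Fin n) ℂ) (x : Fin n → ℂ) :
    star x ⬝ᵥ rePart A *ᵥ x = ((star x ⬝ᵥ A *ᵥ x).re : ℂ) := by
  have h : star x ⬝ᵥ Aᴴ *ᵥ x = star (star x ⬝ᵥ A *ᵥ x) := by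
    rw [star_dotProduct, star_mulVec, conjTranspose_conjTranspose, dotProduct_mulVec]
  rw [rePart_eq, smul_mulVec, add_mulVec, dotProduct_smul, dotProduct_add, h]
  apply Complex.ext <;> simp
  ring

theorem rePart_mono_iff : rePart A ≤ rePart B ↔
    ∀ x : Fin n → ℂ, (star x ⬝ᵥ A *ᵥ x).re ≤ (star x ⬝ᵥ B *ᵥ x).re := by
  rw [Matrix.le_iff, posSemidef_iff_dotProduct_mulVec]
  have key : ∀ x, 0 ≤ star x ⬝ᵥ (rePart B - rePart A) *ᵥ x ↔
      (star x ⬝ᵥ A *ᵥ x).re ≤ (star x ⬝ᵥ B *ᵥ x).re := fun x => by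
    rw [sub_mulVec, dotProduct_sub, rePart_dotProduct, rePart_dotProduct, ← Complex.ofReal_sub,
      ← Complex.ofReal_zero, Complex.real_le_real, sub_nonneg]
  simp only [key]
  exact ⟨fun h => h.2, fun h => ⟨(isHermitian_rePart B).sub (isHermitian_rePart A), h⟩⟩

theorem IsAccretive.isUnit (hA : IsAccretive A) : IsUnit A := by
  rw [← mulVec_injective_iff_isUnit, ← coe_mulVecLin, ← LinearMap.ker_eq_bot,
    LinearMap.ker_eq_bot']
  intro x hx
  by_contra h0
  have h := hA.dotProduct_mulVec_pos h0
  rw [rePart_dotProduct] at h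
  rw [mulVecLin_apply] at hx
  simp [hx] at h

theorem IsAccretive.isUnit_det (hA : IsAccretive A) : IsUnit A.det :=
  (isUnit_iff_isUnit_det A).1 hA.isUnit

theorem rePart_inv (hA : IsUnit A.det) : rePart A⁻¹ = A⁻¹ᴴ * rePart A * A⁻¹ := by
  rw [← rePart_conjTranspose A, ← rePart_conj, ← conjTranspose_mul, mul_nonsing_inv _ hA]
  simp

theorem IsAccretive.inv (hA : IsAccretive A) : IsAccretive A⁻¹ := by
  have hu := hA.isUnit
  unfold IsAccretive
  rw [rePart_inv hA.isUnit_det]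
  exact hA.conjTranspose_mul_mul_same (mulVec_injective_iff_isUnit.2 (by simpa using hu))

theorem IsAccretive.add (hA : IsAccretive A) (hB : IsAccretive B) : IsAccretive (A + B) := by
  unfold IsAccretive
  rw [rePart_add]
  exact PosDef.add hA hB

theorem IsAccretive.smul {r : ℝ} (hr : 0 < r) (hA : IsAccretive A) : IsAccretive (r • A) := by
  unfold IsAccretive
  rw [rePart_smul]
  exact PosDef.smul hA hr

theorem _root_.Matrix.PosDef.isAccretive (hA : A.PosDef) : IsAccretive A := by
  unfold IsAccretive
  rwa [hA.1.rePart_eq_self]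

theorem _root_.Matrix.PosDef.isUnit_det (hA : A.PosDef) : IsUnit A.det :=
  (isUnit_iff_isUnit_det A).1 hA.isUnit

/-- With P = Re A, the difference of the two sides is (P⁻¹ - A⁻¹)ᴴ P (P⁻¹ - A⁻¹). -/
theorem rePart_inv_le (hA : IsAccretive A) : rePart A⁻¹ ≤ (rePart A)⁻¹ := by
  have hP : (rePart A).PosDef := hA
  have h1 : rePart A⁻¹ = A⁻¹ᴴ * rePart A * A⁻¹ := rePart_inv hA.isUnit_det
  have h2 : A⁻¹ + A⁻¹ᴴ = (2 : ℝ) • rePart A⁻¹ := by rw [rePart_eq, smul_smul]; norm_num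
  have h := hP.posSemidef.conjTranspose_mul_mul_same ((rePart A)⁻¹ - A⁻¹)
  refine le_of_sub_eq_posSemidef h ?_
  set P := rePart A
  have e1 : P * P⁻¹ = 1 := mul_nonsing_inv _ hP.isUnit_det
  have e2 : P⁻¹ * P = 1 := nonsing_inv_mul _ hP.isUnit_det
  rw [conjTranspose_sub, hP.1.inv.eq, sub_mul, sub_mul, mul_sub, mul_sub, ← h1, e2, one_mul,
    mul_assoc, e1, mul_one, one_mul, sub_sub_eq_add_sub, sub_add_eq_add_sub, sub_sub,
    h2, two_smul]
  abel

/-- X⁻¹ - Y⁻¹ = (X⁻¹ - Y⁻¹) X (X⁻¹ - Y⁻¹) + Y⁻¹ (Y - X) Y⁻¹. -/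
theorem posDef_inv_le_inv (hX : X.PosDef) (hY : Y.PosDef) (h : X ≤ Y) : Y⁻¹ ≤ X⁻¹ := by
  rw [Matrix.le_iff] at h
  have ha := (hX.posSemidef.conjTranspose_mul_mul_same (X⁻¹ - Y⁻¹)).add
    (h.conjTranspose_mul_mul_same Y⁻¹)
  refine le_of_sub_eq_posSemidef ha ?_
  have e1 : X * X⁻¹ = 1 := mul_nonsing_inv _ hX.isUnit_det
  have e2 : X⁻¹ * X = 1 := nonsing_inv_mul _ hX.isUnit_det
  have e3 : Y⁻¹ * Y = 1 := nonsing_inv_mul _ hY.isUnit_det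
  rw [conjTranspose_sub, hX.1.inv.eq, hY.1.inv.eq]
  simp only [sub_mul, mul_sub, e1, e2, e3, one_mul, mul_assoc, mul_one]
  abel

/-- The parallel sum of accretive matrices dominates the parallel sum of their real parts. -/
theorem parallelSum_rePart_le (hA : IsAccretive A) (hB : IsAccretive B) :
    ((rePart A)⁻¹ + (rePart B)⁻¹)⁻¹ ≤ rePart (A⁻¹ + B⁻¹)⁻¹ := by
  have hP : (rePart A).PosDef := hA
  have hQ : (rePart B).PosDef := hB
  have hR := (hP.inv.add hQ.inv).inv
  have hC : IsUnit (A⁻¹ + B⁻¹).det := (hA.inv.add hB.inv).isUnit_det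
  have hS : IsUnit ((rePart A)⁻¹ + (rePart B)⁻¹).det := (hP.inv.add hQ.inv).isUnit_det
  set P := rePart A
  set Q := rePart B
  set R := (P⁻¹ + Q⁻¹)⁻¹
  set U := (A⁻¹ + B⁻¹)⁻¹
  have hYZ : A⁻¹ * U + B⁻¹ * U = 1 := by rw [← add_mul]; exact mul_nonsing_inv _ hC
  have hAY : A * (A⁻¹ * U) = U := by rw [← mul_assoc, mul_nonsing_inv _ hA.isUnit_det, one_mul]
  have hBZ : B * (B⁻¹ * U) = U := by rw [← mul_assoc, mul_nonsing_inv _ hB.isUnit_det, one_mul]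
  set Y := A⁻¹ * U
  set Z := B⁻¹ * U
  have hYZ' : Yᴴ + Zᴴ = 1 := by rw [← conjTranspose_add, hYZ, conjTranspose_one]
  have hU : rePart U = Yᴴ * P * Y + Zᴴ * Q * Z := by
    rw [← rePart_conj, ← rePart_conj, ← rePart_add, mul_assoc, mul_assoc, hAY, hBZ, ← add_mul,
      hYZ', one_mul]
  -- Subject to Y + Z = 1, the form Yᴴ P Y + Zᴴ Q Z has minimum R, attained at Y = P⁻¹ R, Z = Q⁻¹ R.
  -- These two squares are exactly the excess over R.
  have h := (hP.posSemidef.conjTranspose_mul_mul_same (Y - P⁻¹ * R)).add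
    (hQ.posSemidef.conjTranspose_mul_mul_same (Z - Q⁻¹ * R))
  refine le_of_sub_eq_posSemidef h ?_
  have e1 : P * P⁻¹ = 1 := mul_nonsing_inv _ hP.isUnit_det
  have e3 : Q * Q⁻¹ = 1 := mul_nonsing_inv _ hQ.isUnit_det
  have e2 : P⁻¹ * P = 1 := nonsing_inv_mul _ hP.isUnit_det
  have e4 : Q⁻¹ * Q = 1 := nonsing_inv_mul _ hQ.isUnit_det
  have expand : ∀ {P Y : Matrix (Fin n) (Fin n) ℂ}, P.IsHermitian → P * P⁻¹ = 1 → P⁻¹ * P = 1 →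
      (Y - P⁻¹ * R)ᴴ * P * (Y - P⁻¹ * R) = Yᴴ * P * Y - Yᴴ * R - R * Y + R * P⁻¹ * R := by
    intro P Y hP e1 e2
    rw [conjTranspose_sub, conjTranspose_mul, hP.inv.eq, hR.1.eq, sub_mul, sub_mul, mul_sub,
      mul_sub, mul_assoc R, e2, mul_assoc (Yᴴ) P (P⁻¹ * R), ← mul_assoc P, e1, one_mul, mul_one,
      mul_assoc R]
    abel
  rw [expand hP.1 e1 e2, expand hQ.1 e3 e4, hU]
  have f1 : Yᴴ * R + Zᴴ * R = R := by rw [← add_mul, hYZ', one_mul]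
  have f2 : R * Y + R * Z = R := by rw [← mul_add, hYZ, mul_one]
  have f3 : R * P⁻¹ * R + R * Q⁻¹ * R = R := by
    rw [← add_mul, ← mul_add, nonsing_inv_mul _ hS, one_mul]
  calc _ = Yᴴ * P * Y + Zᴴ * Q * Z - (Yᴴ * R + Zᴴ * R) - (R * Y + R * Z)
        + (R * P⁻¹ * R + R * Q⁻¹ * R) := by rw [f1, f2, f3]; abel
    _ = _ := by abel

/-- With U = tP - Q and V = tP + Q, the gap W = t²P - Q P⁻¹ Q equals both U P⁻¹ V and V P⁻¹ U. As U
+ V = 2tP, the positive matrix U P⁻¹ V P⁻¹ U + V P⁻¹ U P⁻¹ V is 2tW. Dividing by 2t is why t = 0 is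
treated apart. -/
theorem sector_square_le {t : ℝ} (ht : 0 ≤ t) (hP : P.PosDef)
    (hU : (t • P - Q).PosSemidef) (hV : (t • P + Q).PosSemidef) :
    Q * P⁻¹ * Q ≤ t ^ 2 • P := by
  have e1 : P * P⁻¹ = 1 := mul_nonsing_inv _ hP.isUnit_det
  have e2 : P⁻¹ * P = 1 := nonsing_inv_mul _ hP.isUnit_det
  rcases ht.eq_or_lt with rfl | ht
  · have hQ : Q = 0 := le_antisymm (by simpa [Matrix.le_iff] using hU)
      (by simpa [Matrix.le_iff] using hV)
    simp [hQ]
  set W := t ^ 2 • P - Q * P⁻¹ * Q with hW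
  set U := t • P - Q with hUd
  set V := t • P + Q with hVd
  have h1 : U * P⁻¹ * V = W := by
    simp only [hUd, hVd, hW, sub_mul, mul_add, smul_mul_assoc, mul_smul_comm, e1, one_mul,
      mul_assoc, e2, mul_one, smul_sub, smul_smul, pow_two]
    abel
  have h2 : V * P⁻¹ * U = W := by
    simp only [hUd, hVd, hW, add_mul, mul_sub, smul_mul_assoc, mul_smul_comm, e1, one_mul,
      mul_assoc, e2, mul_one, smul_add, smul_smul, pow_two]
    abel
  have h := (hV.conjTranspose_mul_mul_same (P⁻¹ * U)).add
    (hU.conjTranspose_mul_mul_same (P⁻¹ * V))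
  rw [conjTranspose_mul, conjTranspose_mul, hU.1.eq, hV.1.eq, hP.1.inv.eq, h1, h2,
    ← mul_add, ← mul_add] at h
  have h3 : U + V = (2 * t) • P := by
    rw [hUd, hVd, mul_smul, two_smul]
    abel
  rw [h3, mul_smul_comm, mul_smul_comm, e2, mul_one] at h
  have h4 := h.smul (show 0 ≤ (2 * t)⁻¹ by positivity)
  rw [smul_smul, inv_mul_cancel₀ (by positivity), one_smul] at h4
  exact h4

end Algebra

/-! ### Sector bounds and squaring with the Kantorovich constant. -/

section Kantorovich

variable {n : ℕ} {A B P Q X Y : Matrix (Fin n) (Fin n) ℂ} {m M : ℝ}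

/-- The Cartesian decomposition: `rePart (-Complex.I • A)` serves as the imaginary part of A. -/
theorem rePart_add_I_smul (A : Matrix (Fin n) (Fin n) ℂ) :
    rePart A + Complex.I • rePart (-Complex.I • A) = A := by
  rw [rePart_eq, rePart_eq, conjTranspose_smul]
  ext i j
  simp
  linear_combination (-2⁻¹ * A i j + 2⁻¹ * starRingEnd ℂ (A j i)) * Complex.I_sq

theorem re_im_of_numericalRange_subset {α : ℝ} (h : numericalRange A ⊆ sector α)
    (x : Fin n → ℂ) :
    |(star x ⬝ᵥ A *ᵥ x).im| ≤ Real.tan α * (star x ⬝ᵥ A *ᵥ x).re := by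
  rcases eq_or_ne x 0 with rfl | hx
  · simp
  have hpos : 0 < star x ⬝ᵥ x := dotProduct_star_self_pos_iff.2 hx
  obtain ⟨r, hr⟩ : ∃ r : ℝ, star x ⬝ᵥ x = r := ⟨_, Complex.eq_re_of_ofReal_le hpos.le⟩
  have hr0 : 0 < r := by rw [hr] at hpos; exact_mod_cast hpos
  have hs : 0 < Real.sqrt r := Real.sqrt_pos.2 hr0
  have hss : ((Real.sqrt r)⁻¹ * (Real.sqrt r)⁻¹ : ℝ) = r⁻¹ := by
    rw [← mul_inv, Real.mul_self_sqrt hr0.le]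
  have h1 := h ⟨(Real.sqrt r)⁻¹ • x, ?_, rfl⟩
  · rw [mulVec_smul, star_smul, smul_dotProduct, dotProduct_smul, smul_smul, star_trivial, hss] at h1
    obtain ⟨_, h2⟩ := h1
    rw [Complex.smul_im, Complex.smul_re, smul_eq_mul, smul_eq_mul, abs_mul,
      abs_of_pos (inv_pos.2 hr0), mul_left_comm] at h2
    exact le_of_mul_le_mul_left h2 (inv_pos.2 hr0)
  · rw [star_smul, smul_dotProduct, dotProduct_smul, smul_smul, star_trivial, hss, hr,
      Complex.real_smul, ← Complex.ofReal_mul, inv_mul_cancel₀ hr0.ne', Complex.ofReal_one]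

/-- For A = P + iQ the sector condition says -tP ≤ Q ≤ tP with t = tan α. Hence Aᴴ P⁻¹ A = P + Q P⁻¹
Q ≤ (1 + t²) P = sec²α P, and congruence by A⁻¹ gives the claim. -/
theorem inv_rePart_le {α : ℝ} (hα : 0 ≤ α) (hα' : α < Real.pi / 2) (hA : IsAccretive A)
    (h : numericalRange A ⊆ sector α) :
    (rePart A)⁻¹ ≤ (1 / Real.cos α) ^ 2 • rePart A⁻¹ := by
  have hP : (rePart A).PosDef := hA
  have hcos : 0 < Real.cos α := Real.cos_pos_of_mem_Ioo ⟨by linarith [Real.pi_pos], hα'⟩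
  have ht : 0 ≤ Real.tan α := Real.tan_nonneg_of_nonneg_of_le_pi_div_two hα hα'.le
  have hsec : (1 / Real.cos α) ^ 2 = 1 + Real.tan α ^ 2 := by
    rw [one_div, inv_pow, ← Real.inv_one_add_tan_sq hcos.ne', inv_inv]
  set t := Real.tan α
  have key : ∀ x : Fin n → ℂ, (star x ⬝ᵥ (-Complex.I • A) *ᵥ x).re = (star x ⬝ᵥ A *ᵥ x).im := by
    intro x
    rw [smul_mulVec, dotProduct_smul]
    simp
  have key2 : ∀ x : Fin n → ℂ, (star x ⬝ᵥ (t • A) *ᵥ x).re = t * (star x ⬝ᵥ A *ᵥ x).re := by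
    intro x
    rw [smul_mulVec, dotProduct_smul]
    simp
  have hq := rePart_add_I_smul A
  have hU : rePart (-Complex.I • A) ≤ rePart (t • A) := rePart_mono_iff.2 fun x => by
    rw [key, key2]
    exact (abs_le.1 (re_im_of_numericalRange_subset h x)).2
  have hV : rePart ((-1 : ℝ) • t • A) ≤ rePart (-Complex.I • A) := rePart_mono_iff.2 fun x => by
    rw [key, smul_mulVec, dotProduct_smul, Complex.smul_re, key2, smul_eq_mul, neg_one_mul]
    exact (abs_le.1 (re_im_of_numericalRange_subset h x)).1
  have hQ := isHermitian_rePart (-Complex.I • A)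
  rw [rePart_smul, Matrix.le_iff] at hU
  rw [rePart_smul, rePart_smul, Matrix.le_iff, neg_one_smul, sub_neg_eq_add, add_comm] at hV
  set Q := rePart (-Complex.I • A)
  have h1 := sector_square_le ht hP hU hV
  have hinv := rePart_inv hA.isUnit_det
  set P := rePart A
  have e1 : P * P⁻¹ = 1 := mul_nonsing_inv _ hP.isUnit_det
  have e2 : P⁻¹ * P = 1 := nonsing_inv_mul _ hP.isUnit_det
  have h2 : Aᴴ * P⁻¹ * A = P + Q * P⁻¹ * Q := by
    have hstar : Aᴴ = P - Complex.I • Q := by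
      rw [← hq, conjTranspose_add, conjTranspose_smul, hP.1.eq, hQ.eq]
      simp [sub_eq_add_neg]
    have e : (P - Complex.I • Q) * P⁻¹ * A = (P - Complex.I • Q) * P⁻¹ * (P + Complex.I • Q) := by
      rw [hq]
    rw [hstar, e]
    simp only [sub_mul, mul_add, smul_mul_assoc, mul_smul_comm, e1, one_mul,
      mul_assoc, e2, mul_one, smul_sub, smul_smul, Complex.I_mul_I, neg_one_smul]
    abel
  have h3 : (((1 / Real.cos α) ^ 2) • P - Aᴴ * P⁻¹ * A).PosSemidef := by
    have e : (1 / Real.cos α) ^ 2 • P - Aᴴ * P⁻¹ * A = t ^ 2 • P - Q * P⁻¹ * Q := by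
      rw [h2, hsec, add_smul, one_smul]
      abel
    rw [e]
    exact h1
  refine le_of_sub_eq_posSemidef (h3.conjTranspose_mul_mul_same A⁻¹) ?_
  have a1 : A * A⁻¹ = 1 := mul_nonsing_inv _ hA.isUnit_det
  have a2 : A⁻¹ᴴ * Aᴴ = 1 := by rw [← conjTranspose_mul, a1, conjTranspose_one]
  rw [hinv, mul_sub, sub_mul, mul_smul_comm, smul_mul_assoc, mul_assoc (Aᴴ), ← mul_assoc _ (Aᴴ),
    a2, one_mul, mul_assoc _ A, a1, mul_one]

theorem posDef_of_smul_one_le (hm : 0 < m) (hX : m • (1 : Matrix (Fin n) (Fin n) ℂ) ≤ X) :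
    X.PosDef := by
  rw [Matrix.le_iff] at hX
  simpa using PosDef.posSemidef_add hX (PosDef.one.smul hm)

theorem kantorovich_pos {h : ℝ} (hh : 0 < h) : 0 < kantorovich h := by
  unfold kantorovich
  positivity

theorem smul_le_smul_real {r : ℝ} (hr : 0 ≤ r) (h : A ≤ B) : r • A ≤ r • B := by
  refine le_of_sub_eq_posSemidef ((Matrix.le_iff.1 h).smul hr) ?_
  rw [smul_sub]

/-- Squaring preserves the order up to the Kantorovich constant of the smaller matrix. -/
theorem sq_le_kantorovich_smul_sq (hm : 0 < m) (hmM : m ≤ M)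
    (hX : m • (1 : Matrix (Fin n) (Fin n) ℂ) ≤ X) (hX' : X ≤ M • (1 : Matrix (Fin n) (Fin n) ℂ))
    (hY : Y.IsHermitian) (hXY : X ≤ Y) : X ^ 2 ≤ kantorovich (M / m) • Y ^ 2 := by
  have hM : 0 < M := hm.trans_le hmM
  rw [Matrix.le_iff] at hX hX'
  -- The centred form of (X - m)(M - X) ≥ 0, that is, X² ≤ (M + m) X - Mm.
  have h1 : (X - ((M + m) / 2) • 1) * 1⁻¹ * (X - ((M + m) / 2) • 1) ≤ ((M - m) / 2) ^ 2 • 1 := by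
    refine sector_square_le (P := 1) (by linarith) PosDef.one ?_ ?_
    · have e : ((M - m) / 2) • (1 : Matrix (Fin n) (Fin n) ℂ) - (X - ((M + m) / 2) • 1) =
          M • 1 - X := by module
      rwa [e]
    · have e : ((M - m) / 2) • (1 : Matrix (Fin n) (Fin n) ℂ) + (X - ((M + m) / 2) • 1) =
          X - m • 1 := by module
      rwa [e]
  set b := Real.sqrt (M * m) with hb
  have hb2 : b * b = M * m := Real.mul_self_sqrt (by positivity)
  have hb0 : 0 < b := Real.sqrt_pos.2 (by positivity)
  -- With b² = Mm this square is K Y² - (M + m) Y + Mm, so X² ≤ (M + m) X - Mm ≤ (M + m) Y - Mm ≤ K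
  -- Y².
  have h2 := posSemidef_conjTranspose_mul_self (((M + m) / (2 * b)) • Y - b • 1)
  have h3 := (Matrix.le_iff.1 hXY).smul (show 0 ≤ M + m by positivity)
  refine le_of_sub_eq_posSemidef (((Matrix.le_iff.1 h1).add h2).add h3) ?_
  have hK : kantorovich (M / m) = (M + m) / (2 * b) * ((M + m) / (2 * b)) := by
    unfold kantorovich
    rw [div_mul_div_comm, show 2 * b * (2 * b) = 4 * (b * b) by ring, hb2]
    field_simp
  rw [conjTranspose_sub, conjTranspose_smul, conjTranspose_smul, hY.eq, conjTranspose_one, inv_one,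
    star_trivial, star_trivial, hK]
  simp only [mul_sub, sub_mul, mul_one, one_mul, smul_mul_assoc, mul_smul_comm, smul_smul, smul_sub,
    pow_two, hb2]
  have e : (M + m) / (2 * b) * b = (M + m) / 2 := by field_simp
  rw [mul_comm b, e]
  module

theorem inv_smul_real {r : ℝ} (hr : r ≠ 0) (hX : IsUnit X.det) : (r • X)⁻¹ = r⁻¹ • X⁻¹ := by
  refine inv_eq_left_inv ?_
  rw [smul_mul_smul_comm, inv_mul_cancel₀ hr, nonsing_inv_mul _ hX, one_smul]

theorem inv_bounds (hm : 0 < m) (hM : 0 < M)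
    (hX : m • (1 : Matrix (Fin n) (Fin n) ℂ) ≤ X) (hX' : X ≤ M • (1 : Matrix (Fin n) (Fin n) ℂ)) :
    M⁻¹ • (1 : Matrix (Fin n) (Fin n) ℂ) ≤ X⁻¹ ∧
      X⁻¹ ≤ m⁻¹ • (1 : Matrix (Fin n) (Fin n) ℂ) := by
  have hXp := posDef_of_smul_one_le hm hX
  have h1 := posDef_inv_le_inv hXp (PosDef.one.smul hM) hX'
  have h2 := posDef_inv_le_inv (PosDef.one.smul hm) hXp hX
  rw [inv_smul_real hM.ne' PosDef.one.isUnit_det, inv_one] at h1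
  rw [inv_smul_real hm.ne' PosDef.one.isUnit_det, inv_one] at h2
  exact ⟨h1, h2⟩

/-- Squaring preserves the order up to the Kantorovich constant of the larger matrix. -/
theorem sq_le_kantorovich_smul_sq' (hm : 0 < m) (hmM : m ≤ M) (hX : X.PosDef)
    (hY : m • (1 : Matrix (Fin n) (Fin n) ℂ) ≤ Y) (hY' : Y ≤ M • (1 : Matrix (Fin n) (Fin n) ℂ))
    (hXY : X ≤ Y) : X ^ 2 ≤ kantorovich (M / m) • Y ^ 2 := by
  have hM : 0 < M := hm.trans_le hmM
  have hYp := posDef_of_smul_one_le hm hY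
  obtain ⟨h1, h2⟩ := inv_bounds hm hM hY hY'
  have hK : 0 < kantorovich (M / m) := kantorovich_pos (by positivity)
  have sqPos : ∀ {Z : Matrix (Fin n) (Fin n) ℂ}, Z.PosDef → (Z ^ 2).PosDef := by
    intro Z hZ
    have := PosDef.conjTranspose_mul_self Z (mulVec_injective_iff_isUnit.2 hZ.isUnit)
    rwa [hZ.1.eq, ← pow_two] at this
  -- Inversion makes Y⁻¹ the smaller matrix, with bounds 1/M and 1/m of unchanged ratio; inverting
  -- Y⁻² ≤ K X⁻² then returns to X and Y.
  have h := sq_le_kantorovich_smul_sq (inv_pos.2 hM) (inv_anti₀ hm hmM) h1 h2 hX.inv.1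
    (posDef_inv_le_inv hX hYp hXY)
  rw [inv_div_inv] at h
  have h3 := posDef_inv_le_inv (sqPos hYp.inv) ((sqPos hX.inv).smul hK) h
  rw [inv_smul_real hK.ne' (sqPos hX.inv).isUnit_det, ← inv_pow', ← inv_pow',
    nonsing_inv_nonsing_inv _ hX.isUnit_det, nonsing_inv_nonsing_inv _ hYp.isUnit_det] at h3
  simpa [smul_smul, hK.ne'] using smul_le_smul_real hK.le h3

/-- Recovers m ≤ M, which the main theorem does not assume, from the bounds on Re A. -/
theorem le_of_smul_one_le_smul_one (hn : n ≠ 0)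
    (h : m • (1 : Matrix (Fin n) (Fin n) ℂ) ≤ M • (1 : Matrix (Fin n) (Fin n) ℂ)) : m ≤ M := by
  rw [Matrix.le_iff, ← sub_smul] at h
  have := h.diag_nonneg (i := ⟨0, Nat.pos_of_ne_zero hn⟩)
  simp only [Matrix.smul_apply, one_apply_eq, Complex.real_smul, mul_one, Complex.zero_le_real,
    sub_nonneg] at this
  exact this

theorem sq_map_inv_rePart_le {l : ℕ} {α : ℝ} (hm : 0 < m) (hα : 0 ≤ α) (hα' : α < Real.pi / 2)
    (Φ : Matrix (Fin n) (Fin n) ℂ →ₚ[ℂ] Matrix (Fin l) (Fin l) ℂ) (hmM : m ≤ M)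
    (hsec : numericalRange A ⊆ sector α)
    (hA : m • (1 : Matrix (Fin n) (Fin n) ℂ) ≤ rePart A)
    (hA' : rePart A ≤ M • (1 : Matrix (Fin n) (Fin n) ℂ)) (hΦ : Φ 1 = 1) :
    Φ ((rePart A)⁻¹) ^ 2 ≤
        ((1 / Real.cos α) ^ 4 * kantorovich (M / m)) • Φ (rePart A⁻¹) ^ 2 := by
  have hM : 0 < M := hm.trans_le hmM
  have hAcc : IsAccretive A := posDef_of_smul_one_le hm hA
  have hsmul : ∀ (r : ℝ) (X : Matrix (Fin n) (Fin n) ℂ), Φ (r • X) = r • Φ X := by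
    intro r X
    have := map_smul Φ (r : ℂ) X
    rwa [Complex.coe_smul, Complex.coe_smul] at this
  have hmono : Monotone Φ := OrderHomClass.mono Φ
  obtain ⟨h1, h2⟩ := inv_bounds hm hM hA hA'
  have k1 := hmono h1
  have k2 := hmono h2
  have k3 := hmono (inv_rePart_le hα hα' hAcc hsec)
  have k0 := hmono hAcc.inv.posSemidef.nonneg
  rw [hsmul, hΦ] at k1 k2
  rw [map_zero] at k0
  have hherm : (Φ (rePart A⁻¹)).IsHermitian := (nonneg_iff_posSemidef.1 k0).1
  rw [hsmul] at k3
  have := sq_le_kantorovich_smul_sq (inv_pos.2 hM) (inv_anti₀ hm hmM) k1 k2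
    (by rw [IsHermitian, conjTranspose_smul, hherm.eq, star_trivial]) k3
  rw [inv_div_inv, smul_pow, smul_smul, ← pow_mul, mul_comm] at this
  exact this

end Kantorovich

/-! ### The integral defining the mean: convergence, normalization, comparison. -/

section Integral

open MeasureTheory Set

/-- The integral `∫₀^∞ t^(v-1) / (1 + t) dt` is `π / sin (π v)`. -/
theorem integral_rpow_mul_inv_one_add {v : ℝ} (h0 : 0 < v) (h1 : v < 1) :
    ∫ t in Ioi (0 : ℝ), t ^ (v - 1) * (1 + t)⁻¹ = Real.pi / Real.sin (v * Real.pi) := by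
  -- The integral is B(v, 1 - v) after the substitution x = 1 - 1/(1 + t) = t/(1 + t); Euler's
  -- reflection formula evaluates it.
  have hB : Complex.betaIntegral (v : ℂ) ((1 - v : ℝ) : ℂ) =
      ((∫ x in Ioo (0 : ℝ) 1, x ^ (v - 1) * (1 - x) ^ (-v) : ℝ) : ℂ) := by
    rw [Complex.betaIntegral, intervalIntegral.integral_of_le zero_le_one,
      integral_Ioc_eq_integral_Ioo, ← integral_complex_ofReal]
    refine setIntegral_congr_fun measurableSet_Ioo fun x hx => ?_
    simp only [Complex.ofReal_mul]
    rw [Complex.ofReal_cpow hx.1.le, Complex.ofReal_cpow (by linarith [hx.2])]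
    push_cast
    ring_nf
  have hG : Complex.betaIntegral (v : ℂ) ((1 - v : ℝ) : ℂ) =
      ((Real.pi / Real.sin (v * Real.pi) : ℝ) : ℂ) := by
    have := Complex.Gamma_mul_Gamma_eq_betaIntegral (s := (v : ℂ)) (t := ((1 - v : ℝ) : ℂ))
      (by simpa using h0) (by simpa using h1)
    have e : (v : ℂ) + ((1 - v : ℝ) : ℂ) = 1 := by push_cast; ring
    rw [e, Complex.Gamma_one, one_mul, Complex.Gamma_ofReal, Complex.Gamma_ofReal,
      ← Complex.ofReal_mul, Real.Gamma_mul_Gamma_one_sub] at this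
    rw [← this, mul_comm Real.pi v]
  rw [hG] at hB
  have hB' := Complex.ofReal_injective hB
  rw [hB']
  have himg : (fun t : ℝ => 1 - (1 + t)⁻¹) '' Ioi 0 = Ioo 0 1 := by
    ext x
    constructor
    · rintro ⟨t, ht, rfl⟩
      have ht : 0 < t := ht
      have : (1 + t)⁻¹ < 1 := inv_lt_one_of_one_lt₀ (by linarith)
      have h2 : 0 < (1 + t)⁻¹ := by positivity
      constructor <;> simp only <;> linarith
    · rintro ⟨hx0, hx1⟩
      refine ⟨(1 - x)⁻¹ - 1, ?_, ?_⟩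
      · have := one_lt_inv_iff₀.2 ⟨show 0 < 1 - x by linarith, by linarith⟩
        simpa using this
      · simp
  have hinj : InjOn (fun t : ℝ => 1 - (1 + t)⁻¹) (Ioi 0) := by
    intro a _ b _ hab
    have := inv_injective (sub_right_injective hab)
    linarith
  have hderiv : ∀ t ∈ Ioi (0 : ℝ), HasDerivWithinAt (fun t : ℝ => 1 - (1 + t)⁻¹)
      (((1 + t) ^ 2)⁻¹) (Ioi 0) t := by
    intro t ht
    have ht : 0 < t := ht
    have := (((hasDerivAt_id t).const_add 1).inv (by simp; positivity)).const_sub 1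
    refine (this.congr_deriv ?_).hasDerivWithinAt
    simp [div_eq_mul_inv]
  rw [← himg, integral_image_eq_integral_abs_deriv_smul measurableSet_Ioi hderiv hinj]
  refine setIntegral_congr_fun measurableSet_Ioi fun t ht => ?_
  have ht : 0 < t := ht
  have hp : 0 < 1 + t := by positivity
  have e1 : 1 - (1 + t)⁻¹ = t * (1 + t)⁻¹ := by field_simp; ring
  have e2 : 1 - t * (1 + t)⁻¹ = (1 + t)⁻¹ := by field_simp; ring
  rw [e1, e2, abs_of_pos (by positivity), smul_eq_mul, Real.mul_rpow ht.le (by positivity),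
    mul_assoc (t ^ (v - 1)), ← Real.rpow_add (by positivity), show v - 1 + -v = -1 by ring,
    Real.rpow_neg_one, inv_inv]
  field_simp

variable {n : ℕ} {A B C D P Q : Matrix (Fin n) (Fin n) ℂ}

theorem IsAccretive.add_smul_of_nonneg (hC : IsAccretive C) (hD : IsAccretive D) {t : ℝ}
    (ht : 0 ≤ t) : IsAccretive (C + t • D) := by
  unfold IsAccretive
  rw [rePart_add, rePart_smul]
  exact PosDef.add_posSemidef hC (PosSemidef.smul (PosDef.posSemidef hD) ht)

theorem continuousOn_inv_add_smul (hC : IsAccretive C) (hD : IsAccretive D) (i j : Fin n) :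
    ContinuousOn (fun t : ℝ => (C + t • D)⁻¹ i j) (Ici 0) := by
  have hc : Continuous fun t : ℝ => C + t • D := by fun_prop
  simp only [inv_def, Ring.inverse_eq_inv', Matrix.smul_apply]
  refine ContinuousOn.smul (hc.matrix_det.continuousOn.inv₀ fun t ht => ?_)
    (hc.matrix_adjugate.matrix_elem i j).continuousOn
  exact (hC.add_smul_of_nonneg hD ht).isUnit_det.ne_zero

theorem inv_add_smul_eq (hC : IsAccretive C) (hD : IsAccretive D) {t : ℝ} (ht : 0 < t) :
    (C + t • D)⁻¹ = t⁻¹ • (D + t⁻¹ • C)⁻¹ := by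
  have h := (hD.add_smul_of_nonneg hC (inv_pos.2 ht).le).isUnit_det
  refine inv_eq_left_inv ?_
  have e : C + t • D = t • (D + t⁻¹ • C) := by
    rw [smul_add, smul_smul, mul_inv_cancel₀ ht.ne', one_smul, add_comm]
  rw [e, smul_mul_smul_comm, inv_mul_cancel₀ ht.ne', nonsing_inv_mul _ h, one_smul]

/-- On (0, 1] the inverse is bounded by compactness, leaving t^(v-1). For t > 1, `inv_add_smul_eq`
extracts t⁻¹ and leaves a function of t⁻¹ ∈ [0, 1], again bounded, so t^(v-2) dominates. -/
theorem integrableOn_rpow_smul_inv_add_smul {v : ℝ} (h0 : 0 < v) (h1 : v < 1)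
    (hC : IsAccretive C) (hD : IsAccretive D) (i j : Fin n) :
    IntegrableOn (fun t : ℝ => (t ^ (v - 1) : ℝ) • (C + t • D)⁻¹ i j) (Ioi 0) := by
  have hcont : ContinuousOn (fun t : ℝ => (t ^ (v - 1) : ℝ) • (C + t • D)⁻¹ i j) (Ioi 0) := by
    refine ContinuousOn.smul (f := fun t : ℝ => (t ^ (v - 1) : ℝ)) (fun t ht => ?_)
      ((continuousOn_inv_add_smul hC hD i j).mono Ioi_subset_Ici_self)
    exact (Real.continuousAt_rpow_const t _ (Or.inl (ne_of_gt ht))).continuousWithinAt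
  obtain ⟨K, hK⟩ := (isCompact_Icc (a := (0 : ℝ)) (b := 1)).exists_bound_of_continuousOn
    ((continuousOn_inv_add_smul hC hD i j).mono Icc_subset_Ici_self)
  obtain ⟨L, hL⟩ := (isCompact_Icc (a := (0 : ℝ)) (b := 1)).exists_bound_of_continuousOn
    ((continuousOn_inv_add_smul hD hC i j).mono Icc_subset_Ici_self)
  rw [← Ioc_union_Ioi_eq_Ioi (zero_le_one (α := ℝ)), integrableOn_union]
  constructor
  · have hg : IntegrableOn (fun t : ℝ => t ^ (v - 1) * K) (Ioc 0 1) :=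
      ((intervalIntegrable_iff_integrableOn_Ioc_of_le zero_le_one).1
        (intervalIntegral.intervalIntegrable_rpow' (by linarith))).mul_const K
    refine Integrable.mono' hg
      ((hcont.mono Ioc_subset_Ioi_self).aestronglyMeasurable measurableSet_Ioc) ?_
    refine (ae_restrict_iff' measurableSet_Ioc).2 (Filter.Eventually.of_forall fun t ht => ?_)
    have hp : 0 ≤ t ^ (v - 1) := Real.rpow_nonneg ht.1.le _
    rw [norm_smul, Real.norm_of_nonneg hp]
    exact mul_le_mul_of_nonneg_left (hK t ⟨ht.1.le, ht.2⟩) hp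
  · have hg : IntegrableOn (fun t : ℝ => t ^ (v - 2) * L) (Ioi 1) :=
      (integrableOn_Ioi_rpow_of_lt (by linarith) one_pos).mul_const L
    refine Integrable.mono' hg
      ((hcont.mono (Ioi_subset_Ioi zero_le_one)).aestronglyMeasurable measurableSet_Ioi) ?_
    refine (ae_restrict_iff' measurableSet_Ioi).2 (Filter.Eventually.of_forall fun t ht => ?_)
    have ht : 1 < t := ht
    have ht0 : 0 < t := by linarith
    have hp : 0 ≤ t ^ (v - 1) := Real.rpow_nonneg ht0.le _
    rw [inv_add_smul_eq hC hD ht0, Matrix.smul_apply, smul_smul, ← div_eq_mul_inv, norm_smul,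
      Real.norm_of_nonneg (by positivity), ← Real.rpow_sub_one ht0.ne',
      show v - 1 - 1 = v - 2 by ring]
    exact mul_le_mul_of_nonneg_left
      (hL _ ⟨(inv_pos.2 ht0).le, inv_le_one_of_one_le₀ ht.le⟩) (Real.rpow_nonneg ht0.le _)

theorem re_dotProduct_integral_mulVec {f : ℝ → Matrix (Fin n) (Fin n) ℂ} {μ : Measure ℝ}
    (hf : ∀ i j, Integrable (fun t => f t i j) μ) (x : Fin n → ℂ) :
    Integrable (fun t => (star x ⬝ᵥ f t *ᵥ x).re) μ ∧
      (star x ⬝ᵥ (Matrix.of fun i j => ∫ t, f t i j ∂μ) *ᵥ x).re =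
        ∫ t, (star x ⬝ᵥ f t *ᵥ x).re ∂μ := by
  have hi : ∀ i j, Integrable (fun t => star x i * (f t i j * x j)) μ := fun i j =>
    ((hf i j).mul_const _).const_mul _
  have hsum : ∀ t, star x ⬝ᵥ f t *ᵥ x = ∑ i, ∑ j, star x i * (f t i j * x j) := fun t => by
    simp only [dotProduct, mulVec, Finset.mul_sum]
  have hint : Integrable (fun t => star x ⬝ᵥ f t *ᵥ x) μ := by
    simp only [hsum]
    exact integrable_finsetSum _ fun i _ => integrable_finsetSum _ fun j _ => hi i j
  refine ⟨hint.re, ?_⟩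
  have e : ∫ t, (star x ⬝ᵥ f t *ᵥ x).re ∂μ = (∫ t, star x ⬝ᵥ f t *ᵥ x ∂μ).re :=
    integral_re hint
  rw [e]
  congr 1
  simp only [hsum]
  rw [integral_finsetSum _ fun i _ => integrable_finsetSum _ fun j _ => hi i j]
  simp only [dotProduct, mulVec, Finset.mul_sum, Matrix.of_apply]
  refine Finset.sum_congr rfl fun i _ => ?_
  rw [integral_finsetSum _ fun j _ => hi i j]
  refine Finset.sum_congr rfl fun j _ => ?_
  rw [integral_const_mul, integral_mul_const]

theorem geomMean_zero (A B : Matrix (Fin n) (Fin n) ℂ) : geomMean 0 A B = A := by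
  simp [geomMean]

theorem geomMean_one (A B : Matrix (Fin n) (Fin n) ℂ) : geomMean 1 A B = B := by
  simp [geomMean]

theorem geomMean_of_mem_Ioo {v : ℝ} (h0 : 0 < v) (h1 : v < 1) (A B : Matrix (Fin n) (Fin n) ℂ) :
    geomMean v A B = (Real.sin (v * Real.pi) / Real.pi) • Matrix.of fun i j =>
      ∫ t in Ioi (0 : ℝ), ((t ^ (v - 1) : ℝ) • (A⁻¹ + t • B⁻¹)⁻¹) i j := by
  rw [geomMean, if_neg h0.ne', if_neg h1.ne]
  rfl

theorem sin_div_pi_pos {v : ℝ} (h0 : 0 < v) (h1 : v < 1) :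
    0 < Real.sin (v * Real.pi) / Real.pi :=
  div_pos (Real.sin_pos_of_pos_of_lt_pi (mul_pos h0 Real.pi_pos)
    (mul_lt_of_lt_one_left Real.pi_pos h1)) Real.pi_pos

/-- Order between real parts is tested on quadratic forms, which commute with the entrywise
integral. This reduces both comparisons of means and the monotonicity of ♯ to a fixed t. -/
theorem rePart_geomMean_le_smul {A' B' : Matrix (Fin n) (Fin n) ℂ} {v r : ℝ}
    (h0 : 0 < v) (h1 : v < 1) (hA : IsAccretive A) (hB : IsAccretive B) (hA' : IsAccretive A')
    (hB' : IsAccretive B')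
    (h : ∀ t : ℝ, 0 < t → rePart (A⁻¹ + t • B⁻¹)⁻¹ ≤ r • rePart (A'⁻¹ + t • B'⁻¹)⁻¹) :
    rePart (geomMean v A B) ≤ r • rePart (geomMean v A' B') := by
  rw [geomMean_of_mem_Ioo h0 h1, geomMean_of_mem_Ioo h0 h1, rePart_smul, rePart_smul,
    smul_comm]
  refine smul_le_smul_real (sin_div_pi_pos h0 h1).le ?_
  rw [← rePart_smul, rePart_mono_iff]
  intro x
  obtain ⟨i1, e1⟩ := re_dotProduct_integral_mulVec
    (f := fun t : ℝ => (t ^ (v - 1) : ℝ) • (A⁻¹ + t • B⁻¹)⁻¹) (μ := volume.restrict (Ioi 0))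
    (fun i j => integrableOn_rpow_smul_inv_add_smul h0 h1 hA.inv hB.inv i j) x
  obtain ⟨i2, e2⟩ := re_dotProduct_integral_mulVec
    (f := fun t : ℝ => (t ^ (v - 1) : ℝ) • (A'⁻¹ + t • B'⁻¹)⁻¹) (μ := volume.restrict (Ioi 0))
    (fun i j => integrableOn_rpow_smul_inv_add_smul h0 h1 hA'.inv hB'.inv i j) x
  rw [smul_mulVec, dotProduct_smul, Complex.smul_re]
  rw [e1, e2, smul_eq_mul, ← integral_const_mul]
  refine setIntegral_mono_on i1 (i2.const_mul r) measurableSet_Ioi fun t ht => ?_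
  have ht : 0 < t := ht
  have := h t ht
  rw [← rePart_smul, rePart_mono_iff] at this
  have := mul_le_mul_of_nonneg_left (this x) (Real.rpow_nonneg ht.le (v - 1))
  rw [smul_mulVec, dotProduct_smul, Complex.smul_re, smul_eq_mul] at this
  simp only [smul_mulVec, dotProduct_smul, Complex.smul_re, smul_eq_mul] at this ⊢
  linarith

theorem isHermitian_geomMean {v : ℝ} (hP : P.PosDef) (hQ : Q.PosDef) (h0 : 0 ≤ v) (h1 : v ≤ 1) :
    (geomMean v P Q).IsHermitian := by
  rcases h0.eq_or_lt with rfl | h0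
  · rw [geomMean_zero]; exact hP.1
  rcases h1.eq_or_lt with rfl | h1
  · rw [geomMean_one]; exact hQ.1
  rw [geomMean_of_mem_Ioo h0 h1, IsHermitian, conjTranspose_smul, star_trivial]
  congr 1
  ext i j
  rw [conjTranspose_apply, Matrix.of_apply, Matrix.of_apply, RCLike.star_def, ← integral_conj]
  refine setIntegral_congr_fun measurableSet_Ioi fun t ht => ?_
  have ht : 0 < t := ht
  have h : (P⁻¹ + t • Q⁻¹)⁻¹.IsHermitian := (hP.inv.add (hQ.inv.smul ht)).inv.1
  have h' := h.apply i j
  simp only [Matrix.smul_apply]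
  rw [← h']
  simp

/-- The factor sin(vπ)/π cancels the scalar integral; with monotonicity, this yields the bounds m
and M for means. -/
theorem geomMean_smul_one {v m : ℝ} (h0 : 0 < v) (h1 : v < 1) (hm : 0 < m) :
    geomMean v (m • (1 : Matrix (Fin n) (Fin n) ℂ)) (m • 1) = m • 1 := by
  rw [geomMean_of_mem_Ioo h0 h1]
  have key : ∀ t : ℝ, 0 < t → ((m • (1 : Matrix (Fin n) (Fin n) ℂ))⁻¹ + t • (m • 1)⁻¹)⁻¹ =
      (m * (1 + t)⁻¹) • 1 := by
    intro t ht
    have hp : 0 < 1 + t := by positivity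
    rw [inv_smul_real hm.ne' PosDef.one.isUnit_det, inv_one, smul_smul, ← add_smul,
      show m⁻¹ + t * m⁻¹ = (m * (1 + t)⁻¹)⁻¹ by field_simp,
      inv_smul_real (by positivity) PosDef.one.isUnit_det, inv_inv, inv_one]
  ext i j
  rw [Matrix.smul_apply, Matrix.of_apply, Matrix.smul_apply]
  have e : ∫ t in Ioi (0 : ℝ), ((t ^ (v - 1) : ℝ) •
      ((m • (1 : Matrix (Fin n) (Fin n) ℂ))⁻¹ + t • (m • 1)⁻¹)⁻¹) i j =
      ∫ t in Ioi (0 : ℝ), (t ^ (v - 1) * (1 + t)⁻¹) • (m • (1 : Matrix (Fin n) (Fin n) ℂ) i j) := by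
    refine setIntegral_congr_fun measurableSet_Ioi fun t ht => ?_
    rw [key t ht, smul_smul, Matrix.smul_apply, smul_smul]
    congr 1
    ring
  have hs := (sin_div_pi_pos h0 h1).ne'
  rw [e, integral_smul_const, integral_rpow_mul_inv_one_add h0 h1, smul_smul,
    ← inv_div (Real.sin _), mul_inv_cancel₀ hs, one_smul]

end Integral

/-! ### Comparing Re(A ♯ B) with Re A ♯ Re B, and the squared inequalities. -/

section Comparison

variable {n : ℕ} {A B P Q : Matrix (Fin n) (Fin n) ℂ} {v m M α : ℝ}

theorem geomMean_rePart_le (h0 : 0 ≤ v) (h1 : v ≤ 1) (hA : IsAccretive A) (hB : IsAccretive B) :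
    geomMean v (rePart A) (rePart B) ≤ rePart (geomMean v A B) := by
  rcases h0.eq_or_lt with rfl | h0
  · rw [geomMean_zero, geomMean_zero]
  rcases h1.eq_or_lt with rfl | h1
  · rw [geomMean_one, geomMean_one]
  have hP : (rePart A).PosDef := hA
  have hQ : (rePart B).PosDef := hB
  have h := rePart_geomMean_le_smul (r := 1) h0 h1 hP.isAccretive hQ.isAccretive hA hB ?_
  · rwa [one_smul, (isHermitian_geomMean hP hQ h0.le h1.le).rePart_eq_self] at h
  intro t ht
  -- The weight t is absorbed by using t⁻¹B, whose inverse is tB⁻¹.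
  have h := parallelSum_rePart_le hA (hB.smul (inv_pos.2 ht))
  rw [rePart_smul, inv_smul_real (inv_pos.2 ht).ne' hB.isUnit_det,
    inv_smul_real (inv_pos.2 ht).ne' hQ.isUnit_det, inv_inv] at h
  rwa [one_smul, (hP.inv.add (hQ.inv.smul ht)).inv.1.rePart_eq_self]

theorem one_le_sec_sq (hα : 0 ≤ α) (hα' : α < Real.pi / 2) : 1 ≤ (1 / Real.cos α) ^ 2 := by
  have hcos : 0 < Real.cos α := Real.cos_pos_of_mem_Ioo ⟨by linarith [Real.pi_pos], hα'⟩
  exact one_le_pow₀ ((one_le_div hcos).2 (Real.cos_le_one α))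

theorem le_smul_self_of_one_le {r : ℝ} (hr : 1 ≤ r) (hP : P.PosSemidef) : P ≤ r • P :=
  le_of_sub_eq_posSemidef (hP.smul (sub_nonneg.2 hr)) (by rw [sub_smul, one_smul])

/-- With C = A⁻¹ + tB⁻¹, the sector bound gives P⁻¹ + tQ⁻¹ ≤ sec²α Re C, so Re(C⁻¹) ≤ (Re C)⁻¹ ≤
sec²α (P⁻¹ + tQ⁻¹)⁻¹. -/
theorem rePart_geomMean_le (h0 : 0 ≤ v) (h1 : v ≤ 1) (hα : 0 ≤ α) (hα' : α < Real.pi / 2)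
    (hA : IsAccretive A) (hB : IsAccretive B)
    (hsA : numericalRange A ⊆ sector α) (hsB : numericalRange B ⊆ sector α) :
    rePart (geomMean v A B) ≤
      (1 / Real.cos α) ^ 2 • geomMean v (rePart A) (rePart B) := by
  have hP : (rePart A).PosDef := hA
  have hQ : (rePart B).PosDef := hB
  have hs := one_le_sec_sq hα hα'
  rcases h0.eq_or_lt with rfl | h0
  · rw [geomMean_zero, geomMean_zero]
    exact le_smul_self_of_one_le hs hP.posSemidef
  rcases h1.eq_or_lt with rfl | h1
  · rw [geomMean_one, geomMean_one]
    exact le_smul_self_of_one_le hs hQ.posSemidef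
  have h := rePart_geomMean_le_smul (r := (1 / Real.cos α) ^ 2) h0 h1 hA hB hP.isAccretive
    hQ.isAccretive ?_
  · rwa [(isHermitian_geomMean hP hQ h0.le h1.le).rePart_eq_self] at h
  intro t ht
  have hs0 : 0 < (1 / Real.cos α) ^ 2 := by linarith
  have iA := inv_rePart_le hα hα' hA hsA
  have iB := inv_rePart_le hα hα' hB hsB
  set s := (1 / Real.cos α) ^ 2
  have hD : ((rePart A)⁻¹ + t • (rePart B)⁻¹).PosDef := hP.inv.add (hQ.inv.smul ht)
  have hC : IsAccretive (A⁻¹ + t • B⁻¹) := hA.inv.add (hB.inv.smul ht)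
  have hle : (rePart A)⁻¹ + t • (rePart B)⁻¹ ≤ s • rePart (A⁻¹ + t • B⁻¹) := by
    refine le_of_sub_eq_posSemidef ((Matrix.le_iff.1 iA).add ((Matrix.le_iff.1 iB).smul ht.le)) ?_
    rw [rePart_add, rePart_smul, smul_sub, smul_add, smul_comm t s]
    abel
  have h2 := posDef_inv_le_inv hD (PosDef.smul hC hs0) hle
  rw [inv_smul_real hs0.ne' (PosDef.isUnit_det hC)] at h2
  have h3 := smul_le_smul_real hs0.le h2
  rw [smul_smul, mul_inv_cancel₀ hs0.ne', one_smul] at h3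
  rw [hD.inv.1.rePart_eq_self]
  exact (rePart_inv_le hC).trans h3

theorem geomMean_mono {P' Q' : Matrix (Fin n) (Fin n) ℂ} (h0 : 0 ≤ v) (h1 : v ≤ 1)
    (hP : P.PosDef) (hQ : Q.PosDef) (hP' : P'.PosDef) (hQ' : Q'.PosDef)
    (hPP : P ≤ P') (hQQ : Q ≤ Q') : geomMean v P Q ≤ geomMean v P' Q' := by
  rcases h0.eq_or_lt with rfl | h0
  · rwa [geomMean_zero, geomMean_zero]
  rcases h1.eq_or_lt with rfl | h1
  · rwa [geomMean_one, geomMean_one]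
  have h := rePart_geomMean_le_smul (r := 1) h0 h1 hP.isAccretive hQ.isAccretive hP'.isAccretive
    hQ'.isAccretive ?_
  · rwa [one_smul, (isHermitian_geomMean hP hQ h0.le h1.le).rePart_eq_self,
      (isHermitian_geomMean hP' hQ' h0.le h1.le).rePart_eq_self] at h
  intro t ht
  have hD := hP.inv.add (hQ.inv.smul ht)
  have hD' := hP'.inv.add (hQ'.inv.smul ht)
  rw [one_smul, hD.inv.1.rePart_eq_self, hD'.inv.1.rePart_eq_self]
  exact posDef_inv_le_inv hD' hD (add_le_add (posDef_inv_le_inv hP hP' hPP)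
    (smul_le_smul_real ht.le (posDef_inv_le_inv hQ hQ' hQQ)))

theorem geomMean_smul_one_self (h0 : 0 ≤ v) (h1 : v ≤ 1) (hm : 0 < m) :
    geomMean v (m • (1 : Matrix (Fin n) (Fin n) ℂ)) (m • 1) = m • 1 := by
  rcases h0.eq_or_lt with rfl | h0
  · exact geomMean_zero _ _
  rcases h1.eq_or_lt with rfl | h1
  · exact geomMean_one _ _
  exact geomMean_smul_one h0 h1 hm

theorem geomMean_bounds (h0 : 0 ≤ v) (h1 : v ≤ 1) (hm : 0 < m) (hM : 0 < M)
    (hP : m • (1 : Matrix (Fin n) (Fin n) ℂ) ≤ P) (hP' : P ≤ M • (1 : Matrix (Fin n) (Fin n) ℂ))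
    (hQ : m • (1 : Matrix (Fin n) (Fin n) ℂ) ≤ Q) (hQ' : Q ≤ M • (1 : Matrix (Fin n) (Fin n) ℂ)) :
    m • (1 : Matrix (Fin n) (Fin n) ℂ) ≤ geomMean v P Q ∧
      geomMean v P Q ≤ M • (1 : Matrix (Fin n) (Fin n) ℂ) := by
  have pP := posDef_of_smul_one_le hm hP
  have pQ := posDef_of_smul_one_le hm hQ
  have pm : (m • (1 : Matrix (Fin n) (Fin n) ℂ)).PosDef := PosDef.one.smul hm
  have pM : (M • (1 : Matrix (Fin n) (Fin n) ℂ)).PosDef := PosDef.one.smul hM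
  constructor
  · rw [← geomMean_smul_one_self h0 h1 hm]
    exact geomMean_mono h0 h1 pm pm pP pQ hP hQ
  · rw [← geomMean_smul_one_self h0 h1 hM]
    exact geomMean_mono h0 h1 pP pQ pM pM hP' hQ'

theorem sq_geomMean_rePart_le (h0 : 0 ≤ v) (h1 : v ≤ 1) (hm : 0 < m) (hmM : m ≤ M)
    (hA : m • (1 : Matrix (Fin n) (Fin n) ℂ) ≤ rePart A)
    (hA' : rePart A ≤ M • (1 : Matrix (Fin n) (Fin n) ℂ))
    (hB : m • (1 : Matrix (Fin n) (Fin n) ℂ) ≤ rePart B)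
    (hB' : rePart B ≤ M • (1 : Matrix (Fin n) (Fin n) ℂ)) :
    geomMean v (rePart A) (rePart B) ^ 2 ≤
      kantorovich (M / m) • rePart (geomMean v A B) ^ 2 := by
  obtain ⟨h2, h3⟩ := geomMean_bounds h0 h1 hm (hm.trans_le hmM) hA hA' hB hB'
  exact sq_le_kantorovich_smul_sq hm hmM h2 h3 (isHermitian_rePart _)
    (geomMean_rePart_le h0 h1 (posDef_of_smul_one_le hm hA) (posDef_of_smul_one_le hm hB))

theorem sq_rePart_geomMean_le (h0 : 0 ≤ v) (h1 : v ≤ 1) (hα : 0 ≤ α) (hα' : α < Real.pi / 2)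
    (hm : 0 < m) (hmM : m ≤ M)
    (hsA : numericalRange A ⊆ sector α) (hsB : numericalRange B ⊆ sector α)
    (hA : m • (1 : Matrix (Fin n) (Fin n) ℂ) ≤ rePart A)
    (hA' : rePart A ≤ M • (1 : Matrix (Fin n) (Fin n) ℂ))
    (hB : m • (1 : Matrix (Fin n) (Fin n) ℂ) ≤ rePart B)
    (hB' : rePart B ≤ M • (1 : Matrix (Fin n) (Fin n) ℂ)) :
    rePart (geomMean v A B) ^ 2 ≤ ((1 / Real.cos α) ^ 4 * kantorovich (M / m)) •
      geomMean v (rePart A) (rePart B) ^ 2 := by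
  obtain ⟨h2, h3⟩ := geomMean_bounds h0 h1 hm (hm.trans_le hmM) hA hA' hB hB'
  have aA : IsAccretive A := posDef_of_smul_one_le hm hA
  have aB : IsAccretive B := posDef_of_smul_one_le hm hB
  have hX := posDef_of_smul_one_le hm (h2.trans (geomMean_rePart_le h0 h1 aA aB))
  have hs : 0 < (1 / Real.cos α) ^ 2 := by linarith [one_le_sec_sq hα hα']
  have h4 := smul_le_smul_real hs.le h2
  have h5 := smul_le_smul_real hs.le h3
  rw [smul_smul] at h4 h5
  -- The larger matrix is sec²α (P ♯ Q): scaling both bounds keeps the ratio M/m, and squaring the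
  -- factor gives sec⁴α.
  have h := sq_le_kantorovich_smul_sq' (mul_pos hs hm) (mul_le_mul_of_nonneg_left hmM hs.le) hX
    h4 h5 (rePart_geomMean_le h0 h1 hα hα' aA aB hsA hsB)
  rwa [mul_div_mul_left _ _ hs.ne', smul_pow, smul_smul, ← pow_mul, mul_comm] at h

end Comparison

end SectorMatrix

theorem proposition3p1 (n : ℕ) (m M h : ℝ) (hm : 0 < m) (hh : h = M / m) :
    -- (i)
    (∀ (v α : ℝ) (A B : Matrix (Fin n) (Fin n) ℂ),
      0 ≤ v → v ≤ 1 → 0 ≤ α → α < Real.pi / 2 →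
      SectorMatrix.numericalRange A ⊆ SectorMatrix.sector α →
      SectorMatrix.numericalRange B ⊆ SectorMatrix.sector α →
      m • (1 : Matrix (Fin n) (Fin n) ℂ) ≤ SectorMatrix.rePart A →
      SectorMatrix.rePart A ≤ M • (1 : Matrix (Fin n) (Fin n) ℂ) →
      m • (1 : Matrix (Fin n) (Fin n) ℂ) ≤ SectorMatrix.rePart B →
      SectorMatrix.rePart B ≤ M • (1 : Matrix (Fin n) (Fin n) ℂ) →
      SectorMatrix.rePart (SectorMatrix.geomMean v A B) ^ 2 ≤
        ((1 / Real.cos α) ^ 4 * SectorMatrix.kantorovich h) •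
          SectorMatrix.geomMean v (SectorMatrix.rePart A) (SectorMatrix.rePart B) ^ 2) ∧
    -- (ii)
    (∀ (v : ℝ) (A B : Matrix (Fin n) (Fin n) ℂ),
      0 ≤ v → v ≤ 1 →
      SectorMatrix.IsAccretive A → SectorMatrix.IsAccretive B →
      m • (1 : Matrix (Fin n) (Fin n) ℂ) ≤ SectorMatrix.rePart A →
      SectorMatrix.rePart A ≤ M • (1 : Matrix (Fin n) (Fin n) ℂ) →
      m • (1 : Matrix (Fin n) (Fin n) ℂ) ≤ SectorMatrix.rePart B →
      SectorMatrix.rePart B ≤ M • (1 : Matrix (Fin n) (Fin n) ℂ) →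
      SectorMatrix.geomMean v (SectorMatrix.rePart A) (SectorMatrix.rePart B) ^ 2 ≤
        SectorMatrix.kantorovich h •
          SectorMatrix.rePart (SectorMatrix.geomMean v A B) ^ 2) ∧
    -- (iii)
    (∀ (l : ℕ) (α : ℝ) (A : Matrix (Fin n) (Fin n) ℂ)
      (Φ : Matrix (Fin n) (Fin n) ℂ →ₚ[ℂ] Matrix (Fin l) (Fin l) ℂ),
      0 ≤ α → α < Real.pi / 2 →
      SectorMatrix.numericalRange A ⊆ SectorMatrix.sector α →
      m • (1 : Matrix (Fin n) (Fin n) ℂ) ≤ SectorMatrix.rePart A →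
      SectorMatrix.rePart A ≤ M • (1 : Matrix (Fin n) (Fin n) ℂ) →
      Φ 1 = 1 →
      Φ ((SectorMatrix.rePart A)⁻¹) ^ 2 ≤
        ((1 / Real.cos α) ^ 4 * SectorMatrix.kantorovich h) •
          Φ (SectorMatrix.rePart A⁻¹) ^ 2) := by
  subst hh
  rcases eq_or_ne n 0 with rfl | hn
  -- For n = 0 the bounds do not force m ≤ M, but all matrices of size 0 coincide and Φ vanishes.
  · refine ⟨fun _ _ _ _ _ _ _ _ _ _ _ _ _ _ => (Subsingleton.elim _ _).le,
      fun _ _ _ _ _ _ _ _ _ _ _ => (Subsingleton.elim _ _).le,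
      fun l α A Φ _ _ _ _ _ hΦ => le_of_eq ?_⟩
    have h : ∀ X : Matrix (Fin 0) (Fin 0) ℂ, Φ X = 0 := fun X => by
      rw [Subsingleton.elim X 0, map_zero]
    rw [h, h, zero_pow two_ne_zero, smul_zero]
  · refine ⟨fun v α A B h0 h1 hα hα' hsA hsB hA hA' hB hB' => ?_,
      fun v A B h0 h1 _ _ hA hA' hB hB' => ?_, fun l α A Φ hα hα' hs hA hA' hΦ => ?_⟩
    · exact SectorMatrix.sq_rePart_geomMean_le h0 h1 hα hα' hm
        (SectorMatrix.le_of_smul_one_le_smul_one hn (hA.trans hA')) hsA hsB hA hA' hB hB'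
    · exact SectorMatrix.sq_geomMean_rePart_le h0 h1 hm
        (SectorMatrix.le_of_smul_one_le_smul_one hn (hA.trans hA')) hA hA' hB hB'
    · exact SectorMatrix.sq_map_inv_rePart_le hm hα hα' Φ
        (SectorMatrix.le_of_smul_one_le_smul_one hn (hA.trans hA')) hs hA hA' hΦ
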